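/- Let $\mathsf X$ be a non-compact Polish space with its Borel $\sigma$-algebra, $\mu$ a probability measure on $\mathsf X$, $(M_n)_{n\ge1}$ Markov kernels on $\mathsf X$ and $(G_n)_{n\ge0}$ measurable functions $\mathsf X\to(0,\infty)$. Put $Q_n(x,dx'):=G_{n-1}(x)M_n(x,dx')$ and let $\mathbb E_\mu$ be the expectation under the law of the Markov chain $(X_n)_{n\ge0}$ with $X_0\sim\mu$ and $X_n\mid\{X_{n-1}=x\}\sim M_n(x,\cdot)$. For $v:\mathsf X\to[1,\infty)$ let $\|\varphi\|_v:=\sup_x|\varphi(x)|/v(x)$ and let $\mathcal P_v$ be the set of probability measures $\eta$ on $\mathsf X$ with $\eta(v):=\int v\,d\eta<\infty$. Assume: (H1) There are a measurable unbounded $V:\mathsf X\to[1,\infty)$ and constants $\delta>0$, $\underline d\ge1$ such that for each $d\in[\underline d,\infty)$ there is $b_d\in\mathbb R$ with, writing $C_d:=\{x:V(x)\le d\}$, $$\sup_{n\ge1}Q_n(e^V)(x)\le \exp\big(V(x)(1-\delta)+b_d\mathbb I_{C_d}(x)\big)\quad\text{for all }x\in\mathsf X.$$ (H2) $\mu\in\mathcal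 P_v$, where $v:=e^V$. (H3) For each $d\in[\underline d,\infty)$: $Q_n(x,C_d)>0$ for all $x\in\mathsf X$ and $n\ge1$, and there are $\epsilon_d^->0$ and $\nu_d\in\mathcal P_v$, with $\nu_d(C_r)>0$ for all $r\in[\underline d,d]$, such that $\inf_{n\ge1}Q_n(x,C_d\cap A)\ge\epsilon_d^-\nu_d(C_d\cap A)$ for all $x\in C_d$ and all Borel $A$. (H4) For each $d\in[\underline d,\infty)$ there is $\epsilon_d^+\in[\epsilon_d^-,\infty)$ such that $\sup_{n\ge1}Q_n(x,C_d\cap A)\le\epsilon_d^+\nu_d(C_d\cap A)$ for all $x\in C_d$ and all Borel $A$. Then there is a finite constant $c_\mu$, depending only on $\mu$ and the quantities $V,\delta,\underline d,(b_d),(\epsilon_d^\pm),(\nu_d)$ in (H1)–(H4), such that for every collection of measurable functions $F_k:\mathsf X\to\mathbb R$, $k\ge0$, with $\sup_x(|F_k(x)|-\delta V(x))<\infty$ for each $k$, all $n\ge1$, all $0\le s\le n+1$ and all integers $0\le i_1<\dots<i_s\le n$, where in the case $\delta>1$ it is moreover required that $i_s<n$ (if $s\ge1$), one has $0<\mathbb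 E_\mu\big[\prod_{p=0}^{n-1}G_p(X_p)\big]<\infty$ and $$\frac{\mathbb E_\mu\Big[\prod_{p=0}^{n-1}G_p(X_p)\,\exp\Big(\sum_{k\in\{i_1,\dots,i_s\}}|F_k(X_k)|\Big)\Big]}{\mathbb E_\mu\Big[\prod_{p=0}^{n-1}G_p(X_p)\Big]}\le c_\mu^{\,s}\,\mu(v)\prod_{k\in\{i_1,\dots,i_s\}}\big\|e^{|F_k|}\big\|_{v^\delta},$$ where for $s=0$ the sum is $0$ and the product is $1$. -/

import Mathlib

open MeasureTheory ProbabilityTheory Set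
open scoped ENNReal NNReal

noncomputable section

namespace FeynmanKac

/-- The sublevel set `C_d = {x : V x ≤ d}`. -/
def sublevel {X : Type*} (V : X → ℝ) (d : ℝ) : Set X := {x | V x ≤ d}

/-- The weighted supremum norm `‖φ‖_w = sup_x |φ x| / w x`, with value `∞` if the supremum is
infinite. -/
def weightedNorm {X : Type*} (w φ : X → ℝ) : ℝ≥0∞ := ⨆ x, ENNReal.ofReal (|φ x| / w x)

/-- The index set `I_{n,s}` of tuples `0 ≤ i_1 < ... < i_s ≤ n`. -/
def indexTuples (n s : ℕ) : Set (Fin s → ℕ) := {i | StrictMono i ∧ ∀ j, i j ≤ n}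

variable {X : Type*} [MeasurableSpace X]

/-- `η` belongs to `P_v`: it is a probability measure and `η(v) < ∞`. -/
def MemPv (v : X → ℝ) (η : Measure X) : Prop :=
  IsProbabilityMeasure η ∧ ∫⁻ x, ENNReal.ofReal (v x) ∂η < ∞

/-- `Q_n(x, dx') = G_{n-1}(x) M_n(x, dx')`; only the indices `n ≥ 1` are meant. -/
def Q (M : ℕ → Kernel X X) (G : ℕ → X → ℝ) (n : ℕ) (x : X) : Measure X :=
  ENNReal.ofReal (G (n - 1) x) • M n x

/-- The multiplicative drift condition (H1) for `V`, `δ`, `d_` and the constants `b_d`, `d ≥ d_`. -/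
structure DriftCondition (M : ℕ → Kernel X X) (G : ℕ → X → ℝ)
    (V : X → ℝ) (δ dmin : ℝ) (b : ℝ → ℝ) : Prop where
  measurable_V : Measurable V
  one_le_V : ∀ x, 1 ≤ V x
  unbounded_V : ¬ BddAbove (range V)
  delta_pos : 0 < δ
  one_le_dmin : 1 ≤ dmin
  drift : ∀ d, dmin ≤ d → ∀ n, 1 ≤ n → ∀ x,
    ∫⁻ y, ENNReal.ofReal (Real.exp (V y)) ∂(Q M G n x) ≤
      ENNReal.ofReal (Real.exp (V x * (1 - δ) + b d * (sublevel V d).indicator 1 x))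

/-- The local minorization condition (H3). -/
structure MinorizationCondition (M : ℕ → Kernel X X) (G : ℕ → X → ℝ)
    (V : X → ℝ) (dmin : ℝ) (εminus : ℝ → ℝ) (ν : ℝ → Measure X) : Prop where
  accessible : ∀ d, dmin ≤ d → ∀ n, 1 ≤ n → ∀ x, 0 < Q M G n x (sublevel V d)
  eps_pos : ∀ d, dmin ≤ d → 0 < εminus d
  nu_mem : ∀ d, dmin ≤ d → MemPv (fun x => Real.exp (V x)) (ν d)
  minor : ∀ d, dmin ≤ d → ∀ n, 1 ≤ n → ∀ x ∈ sublevel V d, ∀ A, MeasurableSet A →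
    ENNReal.ofReal (εminus d) * ν d (sublevel V d ∩ A) ≤ Q M G n x (sublevel V d ∩ A)
  nu_pos : ∀ d, dmin ≤ d → ∀ r ∈ Icc dmin d, 0 < ν d (sublevel V r)

/-- The local majorization condition (H4). -/
structure MajorizationCondition (M : ℕ → Kernel X X) (G : ℕ → X → ℝ)
    (V : X → ℝ) (dmin : ℝ) (εminus εplus : ℝ → ℝ) (ν : ℝ → Measure X) : Prop where
  eps_le : ∀ d, dmin ≤ d → εminus d ≤ εplus d
  major : ∀ d, dmin ≤ d → ∀ n, 1 ≤ n → ∀ x ∈ sublevel V d, ∀ A, MeasurableSet A →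
    Q M G n x (sublevel V d ∩ A) ≤ ENNReal.ofReal (εplus d) * ν d (sublevel V d ∩ A)

/-- The one-step transition from the history up to time `n` to time `n + 1`: it is `M_{n+1}`
evaluated at the time-`n` coordinate. -/
def step (M : ℕ → Kernel X X) (n : ℕ) : Kernel ((_ : Finset.Iic n) → X) X :=
  (M (n + 1)).comap (fun y => y ⟨n, Finset.mem_Iic.2 le_rfl⟩) (measurable_pi_apply _)

instance (M : ℕ → Kernel X X) [∀ n, IsMarkovKernel (M n)] (n : ℕ) :
    IsMarkovKernel (step M n) := by
  unfold step; infer_instance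

/-- The canonical law on path space of the non-homogeneous Markov chain with `X_0 ∼ μ` and
`X_n | X_{n-1} = x ∼ M_n(x, ·)`. -/
def pathLaw (μ : Measure X) (M : ℕ → Kernel X X) [∀ n, IsMarkovKernel (M n)] :
    Measure (ℕ → X) :=
  Kernel.trajMeasure (X := fun _ => X) μ (step M)

/-- `E_μ[∏_{p=0}^{n-1} G_p(X_p) Φ(X_0, X_1, ...)]` for a nonnegative path functional `Φ`. -/
def weightedExpectation (μ : Measure X) (M : ℕ → Kernel X X) [∀ n, IsMarkovKernel (M n)]
    (G : ℕ → X → ℝ) (n : ℕ) (Φ : (ℕ → X) → ℝ) : ℝ≥0∞ :=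
  ∫⁻ ω, ENNReal.ofReal ((∏ p ∈ Finset.range n, G p (ω p)) * Φ ω) ∂(pathLaw μ M)

end FeynmanKac

end

/-! Write γ_n for the unnormalized measure `flow` at time n, and v = e^V. The drift bounds v^δ(x)
Q_n v(x) by a multiple of v(x) for every δ > 0, so a weight v^δ inserted before time n can be paid
for by the next transition. What remains is to propagate v forward without losing a factor that
grows with time. Three uniform estimates do this. (1) γ_n(v) ≤ R γ_n(C) for a small set C
(`lintegral_flow_le`): far from C the drift contracts faster than C loses mass. (2) γ_n(1) ≤ T
γ_{n+1}(1) (`flow_univ_le_succ`), since C keeps a fixed share of its mass. (3) (Q_{p+1} ⋯ Q_{p+k}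
v)(x) γ_p(1) ≤ S v(x) γ_{p+k}(1) (`semigroup_mul_le`). On a large level set, majorization and
minorization by the same measure compare a start at x with a start from γ_p; outside it, the drift
gives a small factor. By (2) and (3) each weight costs a factor S B T (`lintegral_flow_tilt_le`). A
weight at the final time n has no later transition to absorb it, and is bounded by v itself when δ ≤
1. -/

noncomputable section

namespace FeynmanKac

variable {X : Type*} [MeasurableSpace X]

/-! ### Unnormalized measures and the backward semigroup. -/

/-- The unnormalized Feynman-Kac measures `γ_0 = μ`, `γ_{n+1} = γ_n K_n`. -/
def flow (μ : Measure X) (K : ℕ → Kernel X X) : ℕ → Measure X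
  | 0 => μ
  | n + 1 => (flow μ K n).bind (K n)

/-- The backward semigroup: `semigroup K f k p = K_p K_{p+1} ⋯ K_{p+k-1} f`. -/
def semigroup (K : ℕ → Kernel X X) (f : X → ℝ≥0∞) : ℕ → ℕ → X → ℝ≥0∞
  | 0, _ => f
  | k + 1, p => fun x => ∫⁻ y, semigroup K f k (p + 1) y ∂(K p x)

variable {μ : Measure X} {K : ℕ → Kernel X X} {v : X → ℝ≥0∞}

lemma lintegral_flow_succ (n : ℕ) {f : X → ℝ≥0∞} (hf : Measurable f) :
    ∫⁻ x, f x ∂(flow μ K (n + 1)) = ∫⁻ x, ∫⁻ y, f y ∂(K n x) ∂(flow μ K n) :=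
  Measure.lintegral_bind (K n).measurable.aemeasurable hf.aemeasurable

lemma flow_succ_apply (n : ℕ) {s : Set X} (hs : MeasurableSet s) :
    flow μ K (n + 1) s = ∫⁻ x, K n x s ∂(flow μ K n) :=
  Measure.bind_apply hs (K n).measurable.aemeasurable

lemma measurable_semigroup {f : X → ℝ≥0∞} (hf : Measurable f) (k p : ℕ) :
    Measurable (semigroup K f k p) := by
  induction k generalizing p with
  | zero => exact hf
  | succ k ih => exact (ih (p + 1)).lintegral_kernel

lemma lintegral_flow_add {f : X → ℝ≥0∞} (hf : Measurable f) (k p : ℕ) :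
    ∫⁻ x, f x ∂(flow μ K (p + k)) = ∫⁻ x, semigroup K f k p x ∂(flow μ K p) := by
  induction k generalizing p with
  | zero => rfl
  | succ k ih =>
    rw [show p + (k + 1) = (p + 1) + k by omega, ih (p + 1),
      lintegral_flow_succ p (measurable_semigroup hf k (p + 1))]
    rfl

lemma mul_measure_le_flow_succ {c : ℝ≥0∞} {s t : Set X} (hs : MeasurableSet s)
    (ht : MeasurableSet t) (n : ℕ) (h : ∀ x ∈ s, c ≤ K n x t) :
    c * flow μ K n s ≤ flow μ K (n + 1) t := by
  rw [flow_succ_apply n ht, ← setLIntegral_const]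
  exact (setLIntegral_mono' hs h).trans (setLIntegral_le_lintegral _ _)

lemma measure_le_lintegral (hv1 : ∀ x, 1 ≤ v x) (η : Measure X) (s : Set X) :
    η s ≤ ∫⁻ x, v x ∂η :=
  calc η s ≤ η univ := measure_mono (subset_univ s)
    _ = ∫⁻ _, 1 ∂η := by simp
    _ ≤ ∫⁻ x, v x ∂η := lintegral_mono hv1

/-! ### Stability of the flow. -/

/-- The weight `v` is controlled, along the flow, by the mass of a small set. -/
lemma lintegral_flow_le (hv : Measurable v) {C D : Set X} (hC : MeasurableSet C)
    (hD : MeasurableSet D) {ρ L kC kD R : ℝ≥0∞}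
    (hdrift : ∀ n x, ∫⁻ y, v y ∂(K n x) ≤ ρ * v x + L * D.indicator 1 x)
    (hkC : ∀ n, ∀ x ∈ C, kC ≤ K n x C) (hkD : ∀ n, ∀ x ∈ D, kD ≤ K n x C)
    (hC0 : kC ≠ 0) (hC1 : kC ≠ ∞) (hD0 : kD ≠ 0) (hD1 : kD ≠ ∞)
    (hR0 : ∫⁻ x, v x ∂μ ≤ R * μ C) (hR : ρ * R / kC + L / kD ≤ R) (n : ℕ) :
    ∫⁻ x, v x ∂(flow μ K n) ≤ R * flow μ K n C := by
  induction n with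
  | zero => exact hR0
  | succ n ih =>
    -- One transition returns mass from `C` and from `D` to `C`, so both drift terms are bounded by
    -- the new mass of `C`; `hR` then closes the induction.
    have h1 : flow μ K n C ≤ flow μ K (n + 1) C / kC := by
      rw [ENNReal.le_div_iff_mul_le (.inl hC0) (.inl hC1), mul_comm]
      exact mul_measure_le_flow_succ hC hC n (hkC n)
    have h2 : flow μ K n D ≤ flow μ K (n + 1) C / kD := by
      rw [ENNReal.le_div_iff_mul_le (.inl hD0) (.inl hD1), mul_comm]
      exact mul_measure_le_flow_succ hD hC n (hkD n)
    calc ∫⁻ x, v x ∂(flow μ K (n + 1))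
        ≤ ∫⁻ x, (ρ * v x + L * D.indicator 1 x) ∂(flow μ K n) := by
          rw [lintegral_flow_succ n hv]
          exact lintegral_mono (hdrift n)
      _ = ρ * ∫⁻ x, v x ∂(flow μ K n) + L * flow μ K n D := by
          rw [lintegral_add_left (hv.const_mul ρ), lintegral_const_mul _ hv,
            lintegral_const_mul _ (measurable_one.indicator hD), lintegral_indicator_one hD]
      _ ≤ ρ * (R * (flow μ K (n + 1) C / kC)) + L * (flow μ K (n + 1) C / kD) := by
          gcongr
          exact ih.trans (by gcongr)
      _ = (ρ * R / kC + L / kD) * flow μ K (n + 1) C := by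
          simp only [div_eq_mul_inv]; ring
      _ ≤ R * flow μ K (n + 1) C := by gcongr

/-- The total mass is at most a multiple of the mass of `C`, of which a proportion `kC` survives one
step. -/
lemma flow_univ_le_succ (hv1 : ∀ x, 1 ≤ v x) {C : Set X} (hC : MeasurableSet C) {kC R : ℝ≥0∞}
    (hkC : ∀ n, ∀ x ∈ C, kC ≤ K n x C) (hC0 : kC ≠ 0) (hC1 : kC ≠ ∞) (n : ℕ)
    (hR : ∫⁻ x, v x ∂(flow μ K n) ≤ R * flow μ K n C) :
    flow μ K n univ ≤ R / kC * flow μ K (n + 1) univ := by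
  have h1 : flow μ K n C ≤ flow μ K (n + 1) univ / kC := by
    rw [ENNReal.le_div_iff_mul_le (.inl hC0) (.inl hC1), mul_comm]
    exact (mul_measure_le_flow_succ hC hC n (hkC n)).trans (measure_mono (subset_univ C))
  calc flow μ K n univ ≤ R * flow μ K n C := (measure_le_lintegral hv1 _ _).trans hR
    _ ≤ R * (flow μ K (n + 1) univ / kC) := by gcongr
    _ = R / kC * flow μ K (n + 1) univ := by simp only [div_eq_mul_inv]; ring

/-- A constant multiple of the small-set measure is reached by the flow in one step. -/
lemma mul_setLIntegral_le_lintegral_flow {D : Set X} (hD : MeasurableSet D) {η : Measure X}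
    {e : ℝ≥0∞} (n : ℕ) (h : ∀ x ∈ D, e • η.restrict D ≤ (K n x).restrict D) {f : X → ℝ≥0∞}
    (hf : Measurable f) :
    e * (∫⁻ y in D, f y ∂η) * flow μ K n D ≤ ∫⁻ x, f x ∂(flow μ K (n + 1)) := by
  rw [lintegral_flow_succ n hf, ← setLIntegral_const]
  refine (setLIntegral_mono' hD fun x hx => ?_).trans (setLIntegral_le_lintegral _ _)
  calc e * ∫⁻ y in D, f y ∂η = ∫⁻ y, f y ∂(e • η.restrict D) := by
        rw [lintegral_smul_measure, smul_eq_mul]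
    _ ≤ ∫⁻ y in D, f y ∂(K n x) := lintegral_mono' (h x hx) le_rfl
    _ ≤ ∫⁻ y, f y ∂(K n x) := setLIntegral_le_lintegral _ _

/-! ### Uniform bound for the normalized semigroup. -/

open Classical in
/-- The normalized semigroup applied to `v` is bounded by a multiple of `v`, with a smaller
constant `a * S` off the small set `D`. -/
lemma semigroup_mul_le (hv : Measurable v) (hv1 : ∀ x, 1 ≤ v x) {D : Set X}
    (hD : MeasurableSet D) {η : Measure X} {e e' ρ B R T S a : ℝ≥0∞}
    (hminor : ∀ n, ∀ x ∈ D, e • η.restrict D ≤ (K n x).restrict D)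
    (hmajor : ∀ n, ∀ x ∈ D, (K n x).restrict D ≤ e' • η.restrict D)
    (he0 : e ≠ 0) (he1 : e ≠ ∞)
    (hρ : ∀ n, ∀ x ∉ D, ∫⁻ y, v y ∂(K n x) ≤ ρ * v x)
    (hB : ∀ n x, ∫⁻ y, v y ∂(K n x) ≤ B * v x)
    (hR : ∀ n, ∫⁻ x, v x ∂(flow μ K n) ≤ R * flow μ K n D)
    (hT : ∀ n, flow μ K n univ ≤ T * flow μ K (n + 1) univ)
    (ha : a ≤ 1) (haS : 1 ≤ S * a) (hρT : T * ρ ≤ a)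
    (hS : e' / e * R * R + T * S * a * B ≤ S) (k p : ℕ) (x : X) :
    semigroup K v k p x * flow μ K p univ ≤
      S * (if x ∈ D then v x else a * v x) * flow μ K (p + k) univ := by
  induction k generalizing p x with
  | zero =>
    change v x * _ ≤ _ * flow μ K p univ
    gcongr
    split_ifs
    · calc v x = 1 * v x := (one_mul _).symm
        _ ≤ (S * 1) * v x := by gcongr; exact haS.trans (by gcongr)
        _ = S * v x := by rw [mul_one]
    · calc v x = 1 * v x := (one_mul _).symm
        _ ≤ (S * a) * v x := by gcongr
        _ = S * (a * v x) := by ring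
  | succ k ih =>
    have hidx : p + 1 + k = p + (k + 1) := by omega
    set f := semigroup K v k (p + 1) with hf_def
    have hf : Measurable f := measurable_semigroup hv k (p + 1)
    set g := flow μ K (p + (k + 1)) univ with hg
    have hstep : ∀ y, f y * flow μ K p univ ≤ T * (S * (if y ∈ D then v y else a * v y) * g) := by
      intro y
      calc f y * flow μ K p univ ≤ f y * (T * flow μ K (p + 1) univ) := by gcongr; exact hT p
        _ = T * (f y * flow μ K (p + 1) univ) := by ring
        _ ≤ T * (S * (if y ∈ D then v y else a * v y) * g) := by
          have := ih (p + 1) y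
          rw [hidx] at this
          gcongr
    change (∫⁻ y, f y ∂(K p x)) * flow μ K p univ ≤ _
    by_cases hx : x ∈ D
    · rw [if_pos hx, ← lintegral_add_compl _ hD, add_mul]
      -- The unknown `f` is integrated against `η` on both sides: majorization passes from `K p x`
      -- to `η`, minorization from `η` to the flow. There `f` integrates to the `v`-integral of the
      -- flow at the final time, so no induction hypothesis is needed.
      have h1 : (∫⁻ y in D, f y ∂(K p x)) * flow μ K p univ ≤ e' / e * R * R * g := by
        have hflow : flow μ K p univ ≤ R * flow μ K p D :=
          (measure_le_lintegral hv1 _ _).trans (hR p)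
        calc (∫⁻ y in D, f y ∂(K p x)) * flow μ K p univ
            ≤ (e' * ∫⁻ y in D, f y ∂η) * (R * flow μ K p D) := by
              gcongr
              calc ∫⁻ y in D, f y ∂(K p x) ≤ ∫⁻ y, f y ∂(e' • η.restrict D) :=
                    lintegral_mono' (hmajor p x hx) le_rfl
                _ = e' * ∫⁻ y in D, f y ∂η := by rw [lintegral_smul_measure, smul_eq_mul]
          _ = e' / e * R * (e * (∫⁻ y in D, f y ∂η) * flow μ K p D) := by
              rw [div_eq_mul_inv]
              calc _ = (e⁻¹ * e) * (e' * (∫⁻ y in D, f y ∂η) * (R * flow μ K p D)) := by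
                    rw [ENNReal.inv_mul_cancel he0 he1, one_mul]
                _ = _ := by ring
          _ ≤ e' / e * R * ∫⁻ y, f y ∂(flow μ K (p + 1)) := by
              gcongr
              exact mul_setLIntegral_le_lintegral_flow hD p (hminor p) hf
          _ = e' / e * R * ∫⁻ y, v y ∂(flow μ K (p + (k + 1))) := by
              rw [← hidx, lintegral_flow_add hv k (p + 1)]
          _ ≤ e' / e * R * (R * g) := by
              gcongr
              exact (hR _).trans (mul_le_mul_right (measure_mono (subset_univ D)) R)
          _ = e' / e * R * R * g := by ring
      -- Outside `D` the induction hypothesis carries the extra factor `a`, which keeps the constant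
      -- from growing.
      have h2 : (∫⁻ y in Dᶜ, f y ∂(K p x)) * flow μ K p univ ≤ T * S * a * B * v x * g := by
        rw [← lintegral_mul_const _ hf]
        calc ∫⁻ y in Dᶜ, f y * flow μ K p univ ∂(K p x)
            ≤ ∫⁻ y in Dᶜ, (T * S * a * g) * v y ∂(K p x) := by
              refine setLIntegral_mono' hD.compl fun y hy => (hstep y).trans_eq ?_
              rw [if_neg hy]; ring
          _ ≤ (T * S * a * g) * (B * v x) := by
              refine (setLIntegral_le_lintegral _ _).trans ?_
              rw [lintegral_const_mul _ hv]
              gcongr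
              exact hB p x
          _ = T * S * a * B * v x * g := by ring
      calc _ ≤ e' / e * R * R * g * v x + T * S * a * B * v x * g := by
            refine add_le_add (h1.trans ?_) h2
            exact le_mul_of_one_le_right' (hv1 x)
        _ = (e' / e * R * R + T * S * a * B) * v x * g := by ring
        _ ≤ S * v x * g := by gcongr
    -- The drift factor `ρ` pays for the time shift `T` and still leaves the factor `a`.
    · rw [if_neg hx, ← lintegral_mul_const _ hf]
      calc ∫⁻ y, f y * flow μ K p univ ∂(K p x)
          ≤ ∫⁻ y, (T * S * g) * v y ∂(K p x) := by
            refine lintegral_mono fun y => (hstep y).trans ?_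
            have : (if y ∈ D then v y else a * v y) ≤ v y := by
              split_ifs
              · exact le_rfl
              · exact mul_le_of_le_one_left' ha
            calc _ ≤ T * (S * v y * g) := by gcongr
              _ = _ := by ring
        _ ≤ (T * S * g) * (ρ * v x) := by
            rw [lintegral_const_mul _ hv]
            gcongr
            exact hρ p x hx
        _ = S * g * v x * (T * ρ) := by ring
        _ ≤ S * g * v x * a := by gcongr
        _ = S * (a * v x) * g := by ring

lemma lintegral_flow_ne_top (hv : Measurable v) {B : ℝ≥0∞} (hBt : B ≠ ∞)
    (hB : ∀ n x, ∫⁻ y, v y ∂(K n x) ≤ B * v x) (hμ : ∫⁻ x, v x ∂μ ≠ ∞) (n : ℕ) :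
    ∫⁻ x, v x ∂(flow μ K n) ≠ ∞ := by
  induction n with
  | zero => exact hμ
  | succ n ih =>
    refine ne_top_of_le_ne_top (ENNReal.mul_ne_top hBt ih) ?_
    rw [lintegral_flow_succ n hv, ← lintegral_const_mul _ hv]
    exact lintegral_mono (hB n)

lemma flow_univ_ne_zero [IsProbabilityMeasure μ] {T : ℝ≥0∞}
    (hT : ∀ n, flow μ K n univ ≤ T * flow μ K (n + 1) univ) (n : ℕ) :
    flow μ K n univ ≠ 0 := by
  induction n with
  | zero => simp [flow]
  | succ n ih =>
    intro h
    have := hT n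
    rw [h, mul_zero] at this
    exact ih (le_antisymm this zero_le)

/-! ### Inserting weights at selected times. -/

lemma flow_congr {K' : ℕ → Kernel X X} (n : ℕ) (h : ∀ m < n, K m = K' m) :
    flow μ K n = flow μ K' n := by
  induction n with
  | zero => rfl
  | succ n ih =>
    rw [flow, flow, ih fun m hm => h m (hm.trans n.lt_succ_self), h n n.lt_succ_self]

lemma semigroup_congr {K' : ℕ → Kernel X X} (f : X → ℝ≥0∞) (k p : ℕ)
    (h : ∀ m, p ≤ m → K m = K' m) : semigroup K f k p = semigroup K' f k p := by
  induction k generalizing p with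
  | zero => rfl
  | succ k ih =>
    simp only [semigroup]
    rw [ih (p + 1) fun m hm => h m (by omega), h p le_rfl]

/-- The kernels `K_n`, multiplied by `u` at the times `n ∈ I`. -/
def tilt (K : ℕ → Kernel X X) [∀ n, IsSFiniteKernel (K n)] (u : X → ℝ≥0∞) (I : Finset ℕ) (n : ℕ) : Kernel X X :=
  if n ∈ I then (K n).withDensity (fun x _ => u x) else K n

lemma lintegral_withDensity_fst (κ : Kernel X X) [IsSFiniteKernel κ] {u f : X → ℝ≥0∞}
    (hu : Measurable u) (hf : Measurable f) (x : X) :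
    ∫⁻ y, f y ∂(κ.withDensity (fun x _ => u x) x) = u x * ∫⁻ y, f y ∂(κ x) := by
  rw [Kernel.lintegral_withDensity κ (by fun_prop) x hf, lintegral_const_mul _ hf]

/-- Induction on the latest weighted time `m`: after `m` the semigroup is untilted and `hS` applies;
at `m` the weight is absorbed by `huB`; before `m` only the remaining times matter. The factor `T`
bridges the masses at times `m` and `m + 1`. -/
lemma lintegral_flow_tilt_le [IsProbabilityMeasure μ] [∀ n, IsSFiniteKernel (K n)]
    (hv : Measurable v) {u : X → ℝ≥0∞} (hu : Measurable u) {B T S c : ℝ≥0∞}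
    (huB : ∀ n x, u x * ∫⁻ y, v y ∂(K n x) ≤ B * v x)
    (hS : ∀ k p x, semigroup K v k p x * flow μ K p univ ≤ S * v x * flow μ K (p + k) univ)
    (hT : ∀ n, flow μ K n univ ≤ T * flow μ K (n + 1) univ)
    (hfin : ∀ n, flow μ K n univ ≠ ∞) (hc : S * B * T ≤ c) (I : Finset ℕ) (n : ℕ)
    (hI : ∀ m ∈ I, m < n) :
    ∫⁻ x, v x ∂(flow μ (tilt K u I) n) ≤
      S * c ^ I.card * (∫⁻ x, v x ∂μ) * flow μ K n univ := by
  induction I using Finset.induction_on_max generalizing n with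
  | empty =>
    have : flow μ (tilt K u ∅) n = flow μ K n := flow_congr n fun m _ => by simp [tilt]
    have h0 : flow μ K 0 univ = 1 := by simp [flow]
    rw [this, ← zero_add n, lintegral_flow_add hv n 0, zero_add]
    calc ∫⁻ x, semigroup K v n 0 x ∂μ ≤ ∫⁻ x, (S * flow μ K n univ) * v x ∂μ := by
          refine lintegral_mono fun x => ?_
          have := hS n 0 x
          rw [h0, mul_one, zero_add] at this
          exact this.trans_eq (by ring)
      _ = _ := by rw [lintegral_const_mul _ hv, Finset.card_empty]; ring
  | insert m J hJ ih =>
    have hm : m ∉ J := fun h => lt_irrefl m (hJ m h)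
    obtain ⟨k, rfl⟩ := Nat.exists_eq_add_of_lt (hI m (Finset.mem_insert_self m J))
    rw [show m + k + 1 = (m + 1) + k by omega, Finset.card_insert_of_notMem hm]
    set g := flow μ K (m + 1) univ with hg
    -- The bound `hS` is division-free, so both sides are first multiplied by the nonzero finite
    -- mass at time `m + 1`.
    refine (ENNReal.mul_le_mul_iff_left (flow_univ_ne_zero hT (m + 1)) (hfin (m + 1))).1 ?_
    rw [← hg]
    have hsem : semigroup (tilt K u (insert m J)) v k (m + 1) = semigroup K v k (m + 1) := by
      refine semigroup_congr v k _ fun p hp => if_neg ?_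
      rw [Finset.mem_insert, not_or]
      exact ⟨by omega, fun h => by have := hJ p h; omega⟩
    have hflow : flow μ (tilt K u (insert m J)) m = flow μ (tilt K u J) m := by
      refine flow_congr m fun p hp => ?_
      simp [tilt, hp.ne]
    calc (∫⁻ x, v x ∂(flow μ (tilt K u (insert m J)) (m + 1 + k))) * g
        = ∫⁻ x, semigroup K v k (m + 1) x * g ∂(flow μ (tilt K u (insert m J)) (m + 1)) := by
          rw [lintegral_flow_add hv, hsem, lintegral_mul_const _ (measurable_semigroup hv _ _)]
      _ ≤ ∫⁻ x, (S * flow μ K (m + 1 + k) univ) * v x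
            ∂(flow μ (tilt K u (insert m J)) (m + 1)) :=
          lintegral_mono fun x => (hS k (m + 1) x).trans_eq (by ring)
      _ = (S * flow μ K (m + 1 + k) univ) *
            ∫⁻ x, u x * ∫⁻ y, v y ∂(K m x) ∂(flow μ (tilt K u J) m) := by
          rw [lintegral_const_mul _ hv, lintegral_flow_succ m hv, hflow]
          congr 2 with x
          rw [tilt, if_pos (Finset.mem_insert_self m J), lintegral_withDensity_fst _ hu hv]
      _ ≤ (S * flow μ K (m + 1 + k) univ) * (B * ∫⁻ x, v x ∂(flow μ (tilt K u J) m)) := by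
          gcongr
          rw [← lintegral_const_mul _ hv]
          exact lintegral_mono (huB m)
      _ ≤ (S * flow μ K (m + 1 + k) univ) *
            (B * (S * c ^ J.card * (∫⁻ x, v x ∂μ) * (T * g))) := by
          gcongr
          exact (ih m hJ).trans (by gcongr; exact hT m)
      _ = S * c ^ J.card * (S * B * T) * (∫⁻ x, v x ∂μ) * flow μ K (m + 1 + k) univ * g := by
          ring
      _ ≤ S * c ^ J.card * c * (∫⁻ x, v x ∂μ) * flow μ K (m + 1 + k) univ * g := by gcongr
      _ = _ := by ring

/-! ### Path-space representation of the flow. -/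

lemma lintegral_pathLaw_zero (μ : Measure X) [IsProbabilityMeasure μ] (M : ℕ → Kernel X X)
    [∀ n, IsMarkovKernel (M n)] {f : X → ℝ≥0∞} (hf : Measurable f) :
    ∫⁻ ω, f (ω 0) ∂(pathLaw μ M) = ∫⁻ x, f x ∂μ := by
  have h : (pathLaw μ M).map (Preorder.frestrictLe (π := fun _ => X) 0) =
      μ.map (MeasurableEquiv.piUnique (fun _ : Finset.Iic 0 => X)).symm := by
    rw [pathLaw, Kernel.trajMeasure, Measure.map_comp _ _ (by fun_prop),
      Kernel.traj_map_frestrictLe, Kernel.partialTraj_self, Measure.id_comp]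
  calc ∫⁻ ω, f (ω 0) ∂(pathLaw μ M)
      = ∫⁻ y, f (y ⟨0, Finset.mem_Iic.2 le_rfl⟩)
          ∂((pathLaw μ M).map (Preorder.frestrictLe (π := fun _ => X) 0)) := by
        rw [lintegral_map (by fun_prop) (by fun_prop)]
        rfl
    _ = ∫⁻ x, f x ∂μ := by
        rw [h, lintegral_map (by fun_prop) (MeasurableEquiv.measurable _)]
        rfl

/-- The Markov property, in the product form needed to integrate out the last coordinate. -/
lemma lintegral_pathLaw_succ (μ : Measure X) [IsProbabilityMeasure μ] (M : ℕ → Kernel X X)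
    [∀ n, IsMarkovKernel (M n)] (n : ℕ) {f : ((_ : Finset.Iic n) → X) → ℝ≥0∞} (hf : Measurable f)
    {g : X → ℝ≥0∞} (hg : Measurable g) :
    ∫⁻ ω, f (Preorder.frestrictLe (π := fun _ => X) n ω) * g (ω (n + 1)) ∂(pathLaw μ M) =
      ∫⁻ ω, f (Preorder.frestrictLe (π := fun _ => X) n ω) * ∫⁻ y, g y ∂(M (n + 1) (ω n))
        ∂(pathLaw μ M) := by
  have h := Kernel.map_frestrictLe_trajMeasure_compProd_eq_map_trajMeasure
    (X := fun _ => X) (μ₀ := μ) (κ := step M) (a := n)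
  have hm : Measurable fun q : ((_ : Finset.Iic n) → X) × X => f q.1 * g q.2 := by fun_prop
  calc ∫⁻ ω, f (Preorder.frestrictLe (π := fun _ => X) n ω) * g (ω (n + 1)) ∂(pathLaw μ M)
      = ∫⁻ q, f q.1 * g q.2 ∂((pathLaw μ M).map
          (fun x => (Preorder.frestrictLe (π := fun _ => X) n x, x (n + 1)))) := by
        rw [lintegral_map hm (by fun_prop)]
    _ = ∫⁻ z, ∫⁻ y, f z * g y ∂(step M n z)
          ∂((pathLaw μ M).map (Preorder.frestrictLe (π := fun _ => X) n)) := by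
        rw [pathLaw, ← h]
        have : IsProbabilityMeasure ((Kernel.trajMeasure (X := fun _ => X) μ (step M)).map
            (Preorder.frestrictLe (π := fun _ => X) n)) :=
          Measure.isProbabilityMeasure_map (by fun_prop)
        rw [Measure.lintegral_compProd hm]
    _ = ∫⁻ ω, ∫⁻ y, f (Preorder.frestrictLe (π := fun _ => X) n ω) * g y ∂(M (n + 1) (ω n))
          ∂(pathLaw μ M) := by
        rw [lintegral_map (Measurable.lintegral_kernel_prod_right' (κ := step M n) hm)
          (by fun_prop)]
        rfl
    _ = _ := by simp only [lintegral_const_mul _ hg]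

/-- The unnormalized Feynman-Kac measures are given by weighted expectations on path space. -/
lemma lintegral_pathLaw_prod (μ : Measure X) [IsProbabilityMeasure μ] (M : ℕ → Kernel X X)
    [∀ n, IsMarkovKernel (M n)] (K : ℕ → Kernel X X) {g : ℕ → X → ℝ≥0∞}
    (hg : ∀ n, Measurable (g n))
    (hK : ∀ n x (f : X → ℝ≥0∞), Measurable f →
      ∫⁻ y, f y ∂(K n x) = g n x * ∫⁻ y, f y ∂(M (n + 1) x))
    (n : ℕ) {f : X → ℝ≥0∞} (hf : Measurable f) :
    ∫⁻ ω, (∏ p ∈ Finset.range n, g p (ω p)) * f (ω n) ∂(pathLaw μ M) =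
      ∫⁻ x, f x ∂(flow μ K n) := by
  induction n generalizing f with
  | zero => simpa [flow] using lintegral_pathLaw_zero μ M hf
  | succ n ih =>
    rw [lintegral_flow_succ n hf, ← ih hf.lintegral_kernel]
    -- The product of potentials must be a function of the history up to time `n`, hence the product
    -- over `attach`.
    let F : ((_ : Finset.Iic n) → X) → ℝ≥0∞ := fun z =>
      ∏ p ∈ (Finset.range (n + 1)).attach,
        g p (z ⟨p, Finset.mem_Iic.2 (Nat.lt_succ_iff.1 (Finset.mem_range.1 p.2))⟩)
    have hF : Measurable F :=
      Finset.measurable_fun_prod _ fun p _ => (hg p).comp (measurable_pi_apply _)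
    have hFr : ∀ ω : ℕ → X, F (Preorder.frestrictLe (π := fun _ => X) n ω) =
        ∏ p ∈ Finset.range (n + 1), g p (ω p) := fun ω =>
      Finset.prod_attach (Finset.range (n + 1)) fun p => g p (ω p)
    have h := lintegral_pathLaw_succ μ M n hF hf
    simp only [hFr] at h
    rw [h]
    refine lintegral_congr fun ω => ?_
    rw [Finset.prod_range_succ, mul_assoc, hK n _ f hf]

/-- The kernels `Q_{n+1}` of the Feynman-Kac model. -/
def potentialKernel (M : ℕ → Kernel X X) [∀ n, IsMarkovKernel (M n)] (G : ℕ → X → ℝ)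
    (n : ℕ) : Kernel X X :=
  (M (n + 1)).withDensity (fun x _ => ENNReal.ofReal (G n x))

section PotentialKernel

variable (M : ℕ → Kernel X X) [∀ n, IsMarkovKernel (M n)] {G : ℕ → X → ℝ}

instance (n : ℕ) : IsSFiniteKernel (potentialKernel M G n) := by
  unfold potentialKernel
  exact Kernel.IsSFiniteKernel.withDensity _ fun _ _ => ENNReal.ofReal_ne_top

lemma potentialKernel_apply (hG : ∀ n, Measurable (G n)) (n : ℕ) (x : X) :
    potentialKernel M G n x = Q M G (n + 1) x := by
  have := hG n
  rw [potentialKernel, Kernel.withDensity_apply _ (by fun_prop), withDensity_const]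
  rfl

lemma lintegral_potentialKernel (hG : ∀ n, Measurable (G n)) (n : ℕ) (x : X)
    (f : X → ℝ≥0∞) :
    ∫⁻ y, f y ∂(potentialKernel M G n x) =
      ENNReal.ofReal (G n x) * ∫⁻ y, f y ∂(M (n + 1) x) := by
  rw [potentialKernel_apply M hG, Q, lintegral_smul_measure, smul_eq_mul, Nat.add_sub_cancel]

end PotentialKernel

/-! ### Quantitative consequences of the drift and minorization conditions. -/

lemma measurableSet_sublevel {V : X → ℝ} (hV : Measurable V) (d : ℝ) :
    MeasurableSet (sublevel V d) := measurableSet_le hV measurable_const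

lemma exists_sublevel_pos (μ : Measure X) [IsProbabilityMeasure μ] (V : X → ℝ) (d₀ : ℝ) :
    ∃ d, d₀ ≤ d ∧ μ (sublevel V d) ≠ 0 := by
  by_contra! h
  have hU : (⋃ n : ℕ, sublevel V (max d₀ n)) = univ := by
    refine eq_univ_of_forall fun x => mem_iUnion.2 ?_
    obtain ⟨n, hn⟩ := exists_nat_ge (V x)
    exact ⟨n, hn.trans (le_max_right _ _)⟩
  have h0 : μ (⋃ n : ℕ, sublevel V (max d₀ n)) = 0 :=
    measure_iUnion_null fun n => h _ (le_max_left _ _)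
  rw [hU, measure_univ] at h0
  exact one_ne_zero h0

lemma exists_mul_exp_neg_le {δ : ℝ} (hδ : 0 < δ) {T a : ℝ≥0∞} (hT : T ≠ ∞) (ha : a ≠ 0) (r : ℝ) :
    ∃ d, r ≤ d ∧ T * ENNReal.ofReal (Real.exp (-(δ * d))) ≤ a := by
  have h1 : Filter.Tendsto (fun d : ℝ => Real.exp (-(δ * d))) Filter.atTop (nhds 0) :=
    Real.tendsto_exp_neg_atTop_nhds_zero.comp (Filter.tendsto_id.const_mul_atTop hδ)
  have h2 : Filter.Tendsto (fun d : ℝ => T * ENNReal.ofReal (Real.exp (-(δ * d)))) Filter.atTop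
      (nhds 0) := by
    have := ENNReal.Tendsto.const_mul (ENNReal.tendsto_ofReal h1) (Or.inr hT) (a := T)
    simpa using this
  have h3 := h2.eventually (ge_mem_nhds (pos_iff_ne_zero.2 ha))
  obtain ⟨d, hd1, hd2⟩ := ((Filter.eventually_ge_atTop r).and h3).exists
  exact ⟨d, hd1, hd2⟩

section Drift

variable {M : ℕ → Kernel X X} {G : ℕ → X → ℝ} {V : X → ℝ} {δ dmin : ℝ} {b : ℝ → ℝ}

/-- The loss `-δ V` in the drift exponent exactly cancels the weight v^δ; the absolute value covers
a negative `b dmin`. -/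
lemma DriftCondition.mul_lintegral_le (h : DriftCondition M G V δ dmin b) {n : ℕ} (hn : 1 ≤ n)
    (x : X) :
    ENNReal.ofReal (Real.exp (V x) ^ δ) * ∫⁻ y, ENNReal.ofReal (Real.exp (V y)) ∂(Q M G n x) ≤
      ENNReal.ofReal (Real.exp |b dmin|) * ENNReal.ofReal (Real.exp (V x)) := by
  refine (mul_le_mul_right (h.drift dmin le_rfl n hn x) _).trans ?_
  rw [← ENNReal.ofReal_mul (by positivity), ← ENNReal.ofReal_mul (by positivity),
    ← Real.exp_mul, ← Real.exp_add, ← Real.exp_add]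
  refine ENNReal.ofReal_le_ofReal (Real.exp_le_exp.2 ?_)
  have hb : b dmin * (sublevel V dmin).indicator 1 x ≤ |b dmin| := by
    by_cases hx : x ∈ sublevel V dmin
    · simpa [hx] using le_abs_self _
    · simp [hx]
  linarith

lemma DriftCondition.lintegral_le (h : DriftCondition M G V δ dmin b) {n : ℕ} (hn : 1 ≤ n)
    (x : X) :
    ∫⁻ y, ENNReal.ofReal (Real.exp (V y)) ∂(Q M G n x) ≤
      ENNReal.ofReal (Real.exp |b dmin|) * ENNReal.ofReal (Real.exp (V x)) := by
  refine le_trans (le_mul_of_one_le_left' ?_) (h.mul_lintegral_le hn x)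
  rw [← Real.exp_mul, ENNReal.one_le_ofReal, Real.one_le_exp_iff]
  exact mul_nonneg (zero_le_one.trans (h.one_le_V x)) h.delta_pos.le

lemma DriftCondition.lintegral_le_of_notMem (h : DriftCondition M G V δ dmin b) {n : ℕ}
    (hn : 1 ≤ n) {d : ℝ} (hd : dmin ≤ d) {x : X} (hx : x ∉ sublevel V d) :
    ∫⁻ y, ENNReal.ofReal (Real.exp (V y)) ∂(Q M G n x) ≤
      ENNReal.ofReal (Real.exp (-(δ * d))) * ENNReal.ofReal (Real.exp (V x)) := by
  refine (h.drift d hd n hn x).trans ?_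
  rw [← ENNReal.ofReal_mul (by positivity), ← Real.exp_add]
  refine ENNReal.ofReal_le_ofReal (Real.exp_le_exp.2 ?_)
  have hx' : d < V x := not_le.1 hx
  have := mul_lt_mul_of_pos_left hx' h.delta_pos
  simp only [hx, not_false_eq_true, indicator_of_notMem, mul_zero, add_zero]
  linarith

lemma MinorizationCondition.mul_le {εminus : ℝ → ℝ} {ν : ℝ → Measure X}
    (h : MinorizationCondition M G V dmin εminus ν) (hV : Measurable V) {n : ℕ} (hn : 1 ≤ n)
    {d r : ℝ} (hd : dmin ≤ d) (hr : r ≤ d) {x : X} (hx : x ∈ sublevel V d) :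
    ENNReal.ofReal (εminus d) * ν d (sublevel V r) ≤ Q M G n x (sublevel V r) := by
  have hsub : sublevel V d ∩ sublevel V r = sublevel V r :=
    inter_eq_right.2 fun y hy => le_trans hy hr
  have := h.minor d hd n hn x hx _ (measurableSet_sublevel hV r)
  rwa [hsub] at this

end Drift

/-! ### Choice of the constants. -/

/-- The constants `S`, `c` depend only on `μ` and on the quantities in the drift, minorization and
majorization conditions. -/
lemma exists_tilted_flow_bound (μ : Measure X) {V : X → ℝ} {δ dmin : ℝ}
    (b : ℝ → ℝ) {εminus : ℝ → ℝ} (εplus : ℝ → ℝ) {ν : ℝ → Measure X}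
    (hμ : MemPv (fun x => Real.exp (V x)) μ)
    (hV : Measurable V) (hV1 : ∀ x, 1 ≤ V x) (hδ : 0 < δ)
    (hε : ∀ d, dmin ≤ d → 0 < εminus d)
    (hν : ∀ d, dmin ≤ d → IsProbabilityMeasure (ν d))
    (hνpos : ∀ d, dmin ≤ d → ∀ r ∈ Icc dmin d, 0 < ν d (sublevel V r)) :
    ∃ S c : ℝ≥0, 1 ≤ S ∧ 1 ≤ c ∧
      ∀ (M : ℕ → Kernel X X) [∀ n, IsMarkovKernel (M n)] (G : ℕ → X → ℝ),
      (∀ n, Measurable (G n)) →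
      DriftCondition M G V δ dmin b →
      MinorizationCondition M G V dmin εminus ν →
      MajorizationCondition M G V dmin εminus εplus ν →
      ∀ n : ℕ, flow μ (potentialKernel M G) n univ ≠ 0 ∧
        flow μ (potentialKernel M G) n univ ≠ ∞ ∧
        ∀ I : Finset ℕ, (∀ m ∈ I, m < n) →
          ∫⁻ x, ENNReal.ofReal (Real.exp (V x)) ∂(flow μ (tilt (potentialKernel M G)
              (fun x => ENNReal.ofReal (Real.exp (V x) ^ δ)) I) n) ≤
            S * (c : ℝ≥0∞) ^ I.card * (∫⁻ x, ENNReal.ofReal (Real.exp (V x)) ∂μ) *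
              flow μ (potentialKernel M G) n univ := by
  classical
  obtain ⟨hμP, hμv⟩ := hμ
  set v : X → ℝ≥0∞ := fun x => ENNReal.ofReal (Real.exp (V x)) with hv_def
  have hv : Measurable v := by fun_prop
  have hv1 : ∀ x, 1 ≤ v x := fun x => by
    rw [hv_def, ENNReal.one_le_ofReal, Real.one_le_exp_iff]
    exact zero_le_one.trans (hV1 x)
  set B : ℝ≥0∞ := ENNReal.ofReal (Real.exp |b dmin|) with hB_def
  have hBtop : B ≠ ∞ := ENNReal.ofReal_ne_top
  have hk0 : ∀ d r, dmin ≤ r → r ≤ d → ENNReal.ofReal (εminus d) * ν d (sublevel V r) ≠ 0 :=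
    fun d r hr hd => mul_ne_zero (ENNReal.ofReal_pos.2 (hε d (hr.trans hd))).ne'
      (hνpos d (hr.trans hd) r ⟨hr, hd⟩).ne'
  have hk1 : ∀ d r, dmin ≤ d → ENNReal.ofReal (εminus d) * ν d (sublevel V r) ≠ ∞ :=
    fun d r hd => by
      have := hν d hd
      exact ENNReal.mul_ne_top ENNReal.ofReal_ne_top (measure_ne_top _ _)
  -- The small set is fixed first, charged by `μ` so that the stability bound can start at time 0.
  obtain ⟨r, hr, hμr⟩ := exists_sublevel_pos μ V dmin
  set kC := ENNReal.ofReal (εminus r) * ν r (sublevel V r) with hkC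
  have hkC0 : kC ≠ 0 := hk0 r r hr le_rfl
  have hkC1 : kC ≠ ∞ := hk1 r r hr
  -- With `kC` known, `d` is taken so large that the contraction outside its level set beats the
  -- loss `kC` by a factor 2.
  obtain ⟨d, hrd, hd⟩ := exists_mul_exp_neg_le hδ (ENNReal.inv_ne_top.2 hkC0)
    (a := 2⁻¹) (by simp) r
  have hdmin : dmin ≤ d := hr.trans hrd
  set kD := ENNReal.ofReal (εminus d) * ν d (sublevel V r) with hkD
  have hkD0 : kD ≠ 0 := hk0 d r hr hrd
  have hkD1 : kD ≠ ∞ := hk1 d r hdmin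
  set ρ := ENNReal.ofReal (Real.exp (-(δ * d))) with hρ_def
  set L : ℝ≥0∞ := B * ENNReal.ofReal (Real.exp d) with hL_def
  set R : ℝ≥0∞ := 2 * (L / kD) + (∫⁻ x, v x ∂μ) / μ (sublevel V r) with hR_def
  have hRtop : R ≠ ∞ := by
    refine ENNReal.add_ne_top.2 ⟨ENNReal.mul_ne_top (by simp) (ENNReal.div_ne_top ?_ hkD0),
      ENNReal.div_ne_top hμv.ne hμr⟩
    exact ENNReal.mul_ne_top hBtop ENNReal.ofReal_ne_top
  have hR0 : ∫⁻ x, v x ∂μ ≤ R * μ (sublevel V r) := by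
    rw [hR_def, add_mul, ENNReal.div_mul_cancel hμr (measure_ne_top _ _)]
    exact le_add_self
  have hRfix : ρ * R / kC + L / kD ≤ R := by
    calc ρ * R / kC + L / kD = kC⁻¹ * ρ * R + 2⁻¹ * (2 * (L / kD)) := by
          rw [← mul_assoc, ENNReal.inv_mul_cancel (by simp) (by simp), one_mul, div_eq_mul_inv]
          ring
      _ ≤ 2⁻¹ * R + 2⁻¹ * R := by
          gcongr
          exact le_self_add
      _ = R := by rw [← add_mul, ENNReal.inv_two_add_inv_two, one_mul]
  set T : ℝ≥0∞ := R / kC with hT_def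
  have hTtop : T ≠ ∞ := ENNReal.div_ne_top hRtop hkC0
  have hTBtop : 2 * (T * B) ≠ ∞ := ENNReal.mul_ne_top (by simp) (ENNReal.mul_ne_top hTtop hBtop)
  -- This makes `T * B * a` at most 1/2, so in the semigroup bound half of `S` absorbs the recursive
  -- term and half the term from `D`.
  set a : ℝ≥0∞ := min 1 (2 * (T * B))⁻¹ with ha_def
  have ha0 : a ≠ 0 := by
    simp [ha_def, hTBtop, min_eq_iff]
  have ha1 : a ≤ 1 := min_le_left _ _
  have haTB : T * B * a ≤ 2⁻¹ := by
    rw [ENNReal.le_inv_iff_mul_le]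
    calc T * B * a * 2 ≤ T * B * (2 * (T * B))⁻¹ * 2 := by
          gcongr
          exact min_le_right _ _
      _ = (2 * (T * B)) * (2 * (T * B))⁻¹ := by ring
      _ ≤ 1 := ENNReal.mul_inv_le_one _
  -- A second, larger level is needed: `T` and `a` depend on `r` and `d`, and the drift outside `D`
  -- must beat them.
  obtain ⟨D, hrD, hD⟩ := exists_mul_exp_neg_le hδ hTtop ha0 r
  have hDmin : dmin ≤ D := hr.trans hrD
  set e := ENNReal.ofReal (εminus D) with he_def
  have he0 : e ≠ 0 := (ENNReal.ofReal_pos.2 (hε D hDmin)).ne'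
  set e' := ENNReal.ofReal (εplus D) with he'_def
  set S : ℝ≥0∞ := a⁻¹ + 2 * (e' / e * R * R) with hS_def
  have hStop : S ≠ ∞ := by
    refine ENNReal.add_ne_top.2 ⟨ENNReal.inv_ne_top.2 ha0, ENNReal.mul_ne_top (by simp) ?_⟩
    exact ENNReal.mul_ne_top (ENNReal.mul_ne_top
      (ENNReal.div_ne_top ENNReal.ofReal_ne_top he0) hRtop) hRtop
  have haS : 1 ≤ S * a := by
    rw [hS_def, add_mul, ENNReal.inv_mul_cancel ha0 (ne_top_of_le_ne_top (by simp) ha1)]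
    exact le_self_add
  have hS1 : 1 ≤ S := haS.trans (mul_le_of_le_one_right' ha1)
  have hSfix : e' / e * R * R + T * S * a * B ≤ S := by
    calc e' / e * R * R + T * S * a * B
        = 2⁻¹ * (2 * (e' / e * R * R)) + (T * B * a) * S := by
          rw [← mul_assoc 2⁻¹, ENNReal.inv_mul_cancel (by simp) (by simp), one_mul]
          ring
      _ ≤ 2⁻¹ * S + 2⁻¹ * S := by
          gcongr
          exact le_add_self
      _ = S := by rw [← add_mul, ENNReal.inv_two_add_inv_two, one_mul]
  set c : ℝ≥0∞ := max (S * B * T) 1 with hc_def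
  have hctop : c ≠ ∞ :=
    (max_lt (ENNReal.mul_ne_top (ENNReal.mul_ne_top hStop hBtop) hTtop).lt_top
      ENNReal.one_lt_top).ne
  refine ⟨S.toNNReal, c.toNNReal, ?_, ?_, ?_⟩
  · rwa [← ENNReal.coe_le_coe, ENNReal.coe_toNNReal hStop]
  · rw [← ENNReal.coe_le_coe, ENNReal.coe_toNNReal hctop]
    exact le_max_right _ _
  intro M _ G hG h1 h3 h4
  rw [ENNReal.coe_toNNReal hStop, ENNReal.coe_toNNReal hctop]
  set K := potentialKernel M G with hK_def
  have hKQ : ∀ n x, K n x = Q M G (n + 1) x := potentialKernel_apply M hG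
  have hKB : ∀ n x, ∫⁻ y, v y ∂(K n x) ≤ B * v x := fun n x => by
    rw [hKQ]; exact h1.lintegral_le (by omega) x
  have hKρ : ∀ D', dmin ≤ D' → ∀ n, ∀ x ∉ sublevel V D',
      ∫⁻ y, v y ∂(K n x) ≤ ENNReal.ofReal (Real.exp (-(δ * D'))) * v x :=
    fun D' hD' n x hx => by
      rw [hKQ]; exact h1.lintegral_le_of_notMem (by omega) hD' hx
  have hKk : ∀ D', r ≤ D' → ∀ n, ∀ x ∈ sublevel V D',
      ENNReal.ofReal (εminus D') * ν D' (sublevel V r) ≤ K n x (sublevel V r) :=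
    fun D' hD' n x hx => by
      rw [hKQ]; exact h3.mul_le hV (by omega) (hr.trans hD') hD' hx
  have hCm := measurableSet_sublevel hV r
  have hRflow : ∀ n, ∫⁻ x, v x ∂(flow μ K n) ≤ R * flow μ K n (sublevel V r) := by
    refine lintegral_flow_le hv hCm (measurableSet_sublevel hV d) (ρ := ρ) (L := L)
      (fun n x => ?_) (hKk r le_rfl) (hKk d hrd) hkC0 hkC1 hkD0 hkD1 hR0 hRfix
    by_cases hx : x ∈ sublevel V d
    · refine (hKB n x).trans (le_add_left ?_)
      rw [indicator_of_mem hx, Pi.one_apply, mul_one]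
      exact mul_le_mul_right (ENNReal.ofReal_le_ofReal (Real.exp_le_exp.2 hx)) _
    · exact (hKρ d hdmin n x hx).trans le_self_add
  have hTflow : ∀ n, flow μ K n univ ≤ T * flow μ K (n + 1) univ := fun n =>
    flow_univ_le_succ hv1 hCm (hKk r le_rfl) hkC0 hkC1 n (hRflow n)
  have hfin : ∀ n, flow μ K n univ ≠ ∞ := fun n =>
    ne_top_of_le_ne_top (lintegral_flow_ne_top hv hBtop hKB hμv.ne n) (measure_le_lintegral hv1 _ _)
  have hDm := measurableSet_sublevel hV D
  have hsem : ∀ k p x, semigroup K v k p x * flow μ K p univ ≤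
      S * v x * flow μ K (p + k) univ := by
    intro k p x
    refine (semigroup_mul_le hv hv1 hDm (η := ν D) (e := e) (e' := e') (a := a) ?_ ?_
      he0 ENNReal.ofReal_ne_top (hKρ D hDmin) hKB (R := R) (fun n => (hRflow n).trans ?_) hTflow
      ha1 haS hD hSfix k p x).trans ?_
    · intro n x hx
      refine Measure.le_iff.2 fun A hA => ?_
      rw [Measure.smul_apply, Measure.restrict_apply hA, Measure.restrict_apply hA, smul_eq_mul,
        inter_comm, hKQ]
      exact h3.minor D hDmin (n + 1) (by omega) x hx A hA
    · intro n x hx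
      refine Measure.le_iff.2 fun A hA => ?_
      rw [Measure.smul_apply, Measure.restrict_apply hA, Measure.restrict_apply hA, smul_eq_mul,
        inter_comm, hKQ]
      exact h4.major D hDmin (n + 1) (by omega) x hx A hA
    · exact mul_le_mul_right (measure_mono fun y hy => le_trans hy hrD) _
    · gcongr
      split_ifs
      · exact le_rfl
      · exact mul_le_of_le_one_left' ha1
  refine fun n => ⟨flow_univ_ne_zero hTflow n, hfin n, fun I hI => ?_⟩
  exact lintegral_flow_tilt_le hv (by fun_prop) (fun n x => by
    rw [hKQ]; exact h1.mul_lintegral_le (by omega) x) hsem hTflow hfin (le_max_left _ _) I n hI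

/-! ### From weighted expectations to tilted flows. -/

lemma weightedExpectation_one (μ : Measure X) [IsProbabilityMeasure μ] (M : ℕ → Kernel X X)
    [∀ n, IsMarkovKernel (M n)] {G : ℕ → X → ℝ} (hG : ∀ n, Measurable (G n))
    (hG0 : ∀ n x, 0 < G n x) (n : ℕ) :
    weightedExpectation μ M G n (fun _ => 1) = flow μ (potentialKernel M G) n univ := by
  have h := lintegral_pathLaw_prod μ M (potentialKernel M G)
    (g := fun n x => ENNReal.ofReal (G n x)) (fun n => (hG n).ennreal_ofReal)
    (fun n x f _ => lintegral_potentialKernel M hG n x f) n (f := fun _ => 1) measurable_const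
  simp only [mul_one, lintegral_one] at h
  rw [← h, weightedExpectation]
  refine lintegral_congr fun ω => ?_
  rw [mul_one, ENNReal.ofReal_prod_of_nonneg fun p _ => (hG0 p _).le]

lemma ofReal_le_weightedNorm_mul {Y : Type*} {w φ : Y → ℝ} (hw : ∀ x, 0 < w x)
    (hφ : ∀ x, 0 ≤ φ x) (x : Y) :
    ENNReal.ofReal (φ x) ≤ weightedNorm w φ * ENNReal.ofReal (w x) := by
  have h : ENNReal.ofReal (|φ x| / w x) ≤ weightedNorm w φ :=
    le_iSup (fun x => ENNReal.ofReal (|φ x| / w x)) x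
  calc ENNReal.ofReal (φ x) = ENNReal.ofReal (|φ x| / w x) * ENNReal.ofReal (w x) := by
        rw [← ENNReal.ofReal_mul (div_nonneg (abs_nonneg _) (hw x).le),
          div_mul_cancel₀ _ (hw x).ne', abs_of_nonneg (hφ x)]
    _ ≤ _ := by gcongr

/-- Each exponential is at most its norm times v^δ. Weights at times before `n` go into the tilted
kernels; one at time `n` is dominated by the terminal function v, which is where `hδ` enters. -/
lemma weightedExpectation_exp_le (μ : Measure X) [IsProbabilityMeasure μ] (M : ℕ → Kernel X X)
    [∀ n, IsMarkovKernel (M n)] {G : ℕ → X → ℝ} (hG : ∀ n, Measurable (G n))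
    (hG0 : ∀ n x, 0 < G n x) {V : X → ℝ} (hV : Measurable V) (hV0 : ∀ x, 0 ≤ V x) {δ : ℝ}
    (F : ℕ → X → ℝ) {n s : ℕ} {i : Fin s → ℕ} (hi : i ∈ indexTuples n s)
    (hδ : δ ≤ 1 ∨ ∀ j, i j < n) :
    weightedExpectation μ M G n (fun ω => Real.exp (∑ j, |F (i j) (ω (i j))|)) ≤
      (∏ j, weightedNorm (fun x => Real.exp (V x) ^ δ) (fun x => Real.exp |F (i j) x|)) *
      ∫⁻ x, ENNReal.ofReal (Real.exp (V x)) ∂(flow μ (tilt (potentialKernel M G)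
        (fun x => ENNReal.ofReal (Real.exp (V x) ^ δ))
          ((Finset.univ.image i).filter (· < n))) n) := by
  classical
  set u : X → ℝ≥0∞ := fun x => ENNReal.ofReal (Real.exp (V x) ^ δ) with hu_def
  have hu : Measurable u := by fun_prop
  set N := ∏ j, weightedNorm (fun x => Real.exp (V x) ^ δ) (fun x => Real.exp |F (i j) x|)
  set I := Finset.univ.image i with hI
  set J := I.filter (· < n) with hJ
  set g : ℕ → X → ℝ≥0∞ := fun p x => (if p ∈ J then u x else 1) * ENNReal.ofReal (G p x) with hg_def
  have hg : ∀ p, Measurable (g p) := fun p => by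
    have := hG p
    by_cases hp : p ∈ J <;> simp only [hg_def, hp, if_true, if_false] <;> fun_prop
  have hpath := lintegral_pathLaw_prod μ M (tilt (potentialKernel M G) u J) hg
    (fun p x f hf => by
      by_cases hp : p ∈ J
      · simp only [tilt, hg_def, hp, if_true]
        rw [lintegral_withDensity_fst _ hu hf, lintegral_potentialKernel M hG, mul_assoc]
      · simp only [tilt, hg_def, hp, if_false]
        rw [lintegral_potentialKernel M hG, one_mul]) n
    (f := fun x => ENNReal.ofReal (Real.exp (V x))) (by fun_prop)
  have hmeas : Measurable fun ω : ℕ → X =>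
      (∏ p ∈ Finset.range n, g p (ω p)) * ENNReal.ofReal (Real.exp (V (ω n))) := by
    have : Measurable fun ω : ℕ → X => ∏ p ∈ Finset.range n, g p (ω p) :=
      Finset.measurable_fun_prod _ fun p _ => (hg p).comp (measurable_pi_apply p)
    fun_prop
  rw [← hpath, ← lintegral_const_mul _ hmeas]
  refine lintegral_mono fun ω => ?_
  have hlast : (if n ∈ I then u (ω n) else 1) ≤ ENNReal.ofReal (Real.exp (V (ω n))) := by
    split_ifs with hn
    · have hδ1 : δ ≤ 1 := by
        refine hδ.resolve_right fun h => ?_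
        obtain ⟨j, -, hj⟩ := Finset.mem_image.1 hn
        exact (h j).ne hj
      rw [hu_def]
      refine ENNReal.ofReal_le_ofReal ?_
      rw [← Real.exp_mul]
      exact Real.exp_le_exp.2 (mul_le_of_le_one_right (hV0 _) hδ1)
    · rw [ENNReal.one_le_ofReal, Real.one_le_exp_iff]
      exact hV0 _
  have hIn : I ⊆ Finset.range (n + 1) := fun p hp => by
    obtain ⟨j, -, rfl⟩ := Finset.mem_image.1 hp
    exact Finset.mem_range.2 (Nat.lt_succ_of_le (hi.2 j))
  have hprod : ∏ j, u (ω (i j)) =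
      (∏ p ∈ Finset.range n, if p ∈ J then u (ω p) else 1) * (if n ∈ I then u (ω n) else 1) := by
    rw [← Finset.prod_image (s := Finset.univ) (g := i) (f := fun p => u (ω p))
      (fun _ _ _ _ h => hi.1.injective h), ← hI, ← Finset.inter_eq_right.2 hIn,
      ← Finset.prod_ite_mem, Finset.inter_eq_right.2 hIn, Finset.prod_range_succ]
    congr 1
    refine Finset.prod_congr rfl fun p hp => ?_
    simp [hJ, Finset.mem_range.1 hp]
  calc ENNReal.ofReal ((∏ p ∈ Finset.range n, G p (ω p)) *
          Real.exp (∑ j, |F (i j) (ω (i j))|))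
      = (∏ p ∈ Finset.range n, ENNReal.ofReal (G p (ω p))) *
          ∏ j, ENNReal.ofReal (Real.exp |F (i j) (ω (i j))|) := by
        rw [Real.exp_sum, ENNReal.ofReal_mul (Finset.prod_nonneg fun p _ => (hG0 p _).le),
          ENNReal.ofReal_prod_of_nonneg fun p _ => (hG0 p _).le,
          ENNReal.ofReal_prod_of_nonneg fun j _ => (Real.exp_pos _).le]
    _ ≤ (∏ p ∈ Finset.range n, ENNReal.ofReal (G p (ω p))) * (N * ∏ j, u (ω (i j))) := by
        rw [← Finset.prod_mul_distrib]
        gcongr with j _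
        exact ofReal_le_weightedNorm_mul (w := fun x => Real.exp (V x) ^ δ)
          (φ := fun x => Real.exp |F (i j) x|) (fun x => by positivity)
          (fun x => (Real.exp_pos _).le) _
    _ = N * ((∏ p ∈ Finset.range n, g p (ω p)) * (if n ∈ I then u (ω n) else 1)) := by
        rw [hprod]
        simp only [hg_def, Finset.prod_mul_distrib]
        ring
    _ ≤ _ := by gcongr

end FeynmanKac

end

theorem theorem4 {X : Type*} [TopologicalSpace X] [PolishSpace X] [NoncompactSpace X]
    [MeasurableSpace X] [BorelSpace X]
    (μ : Measure X) (V : X → ℝ) (δ dmin : ℝ) (b εminus εplus : ℝ → ℝ) (ν : ℝ → Measure X)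
    (H2 : FeynmanKac.MemPv (fun x => Real.exp (V x)) μ) :
    ∃ c : ℝ≥0, ∀ (M : ℕ → Kernel X X) [∀ n, IsMarkovKernel (M n)] (G : ℕ → X → ℝ),
      (∀ n, Measurable (G n)) → (∀ n x, 0 < G n x) →
      FeynmanKac.DriftCondition M G V δ dmin b →
      FeynmanKac.MinorizationCondition M G V dmin εminus ν →
      FeynmanKac.MajorizationCondition M G V dmin εminus εplus ν →
      ∀ F : ℕ → X → ℝ, (∀ k, Measurable (F k)) →
        (∀ k, BddAbove (Set.range fun x => |F k x| - δ * V x)) →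
      ∀ n s : ℕ, 1 ≤ n → s ≤ n + 1 → ∀ i ∈ FeynmanKac.indexTuples n s,
        (δ ≤ 1 ∨ ∀ j, i j < n) →
        FeynmanKac.weightedExpectation μ M G n (fun _ => 1) ≠ 0 ∧
        FeynmanKac.weightedExpectation μ M G n (fun _ => 1) ≠ ∞ ∧
        FeynmanKac.weightedExpectation μ M G n
              (fun ω => Real.exp (∑ j, |F (i j) (ω (i j))|)) /
            FeynmanKac.weightedExpectation μ M G n (fun _ => 1) ≤
          (c : ℝ≥0∞) ^ s * (∫⁻ x, ENNReal.ofReal (Real.exp (V x)) ∂μ) *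
            ∏ j, FeynmanKac.weightedNorm (fun x => Real.exp (V x) ^ δ)
              (fun x => Real.exp |F (i j) x|) := by
  classical
  -- The constant is chosen before `M` and `G`, so the properties of the data alone are isolated
  -- here; if they fail, no model satisfies the hypotheses and any constant works.
  by_cases hconst : Measurable V ∧ (∀ x, 1 ≤ V x) ∧ 0 < δ ∧ (∀ d, dmin ≤ d → 0 < εminus d) ∧
      (∀ d, dmin ≤ d → IsProbabilityMeasure (ν d)) ∧
      (∀ d, dmin ≤ d → ∀ r ∈ Icc dmin d, 0 < ν d (FeynmanKac.sublevel V r))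
  swap
  · exact ⟨0, fun M _ G _ _ h1 h3 _ => absurd ⟨h1.measurable_V, h1.one_le_V, h1.delta_pos,
      h3.eps_pos, fun d hd => (h3.nu_mem d hd).1, h3.nu_pos⟩ hconst⟩
  obtain ⟨hV, hV1, hδ, hε, hν, hνpos⟩ := hconst
  obtain ⟨S, c, hS, hc, hbound⟩ :=
    FeynmanKac.exists_tilted_flow_bound μ b εplus H2 hV hV1 hδ hε hν hνpos
  have hμ := H2.1
  have hV0 : ∀ x, 0 ≤ V x := fun x => zero_le_one.trans (hV1 x)
  refine ⟨S * c, fun M _ G hG hG0 h1 h3 h4 F _ _ n s _ _ i hi hi' => ?_⟩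
  obtain ⟨hne, htop, htilt⟩ := hbound M G hG h1 h3 h4 n
  rw [FeynmanKac.weightedExpectation_one μ M hG hG0]
  refine ⟨hne, htop, ?_⟩
  rw [ENNReal.div_le_iff hne htop]
  -- The prefactor `S` fits into the s-th power only for s ≥ 1; for s = 0 the ratio is 1 and the
  -- integral of v against `μ` is at least 1.
  rcases Nat.eq_zero_or_pos s with rfl | hs
  · simp only [Finset.univ_eq_empty, Finset.sum_empty, Real.exp_zero, Finset.prod_empty, pow_zero,
      one_mul, mul_one]
    rw [FeynmanKac.weightedExpectation_one μ M hG hG0]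
    refine le_mul_of_one_le_left' ?_
    refine le_trans (by simp) (FeynmanKac.measure_le_lintegral (fun x => ?_) μ univ)
    rw [ENNReal.one_le_ofReal, Real.one_le_exp_iff]
    exact hV0 x
  · refine (FeynmanKac.weightedExpectation_exp_le μ M hG hG0 hV hV0 F hi hi').trans ?_
    set J := (Finset.univ.image i).filter (· < n)
    have hJs : J.card ≤ s := by
      refine (Finset.card_filter_le _ _).trans (Finset.card_image_le.trans ?_)
      simp
    have hpow : S * c ^ J.card ≤ (S * c) ^ s := by
      rw [mul_pow]
      exact mul_le_mul' (le_self_pow₀ hS hs.ne') (pow_le_pow_right₀ hc hJs)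
    have hpow' : (S : ℝ≥0∞) * (c : ℝ≥0∞) ^ J.card ≤ ((S * c : ℝ≥0) : ℝ≥0∞) ^ s := by
      exact_mod_cast hpow
    refine (mul_le_mul_right (htilt J fun m hm => (Finset.mem_filter.1 hm).2) _).trans ?_
    calc _ ≤ _ * (((S * c : ℝ≥0) : ℝ≥0∞) ^ s * (∫⁻ x, ENNReal.ofReal (Real.exp (V x)) ∂μ) *
          FeynmanKac.flow μ (FeynmanKac.potentialKernel M G) n univ) := by gcongr
      _ = _ := by ring
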